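/- Let $K$ be a field, let $k\ge 1$ and $n\ge 3$ be integers, and let $S=K[x_1,\dots,x_n]$. Let $C_n$ be the cycle on the vertex set $\{1,\dots,n\}$, and let $C_n^k$ be its $k$-th power: the simple graph on the same vertices in which two distinct vertices are adjacent if and only if their distance in $C_n$ is at most $k$. Let $I(C_n^k)=(x_ix_j : \{i,j\}\in E(C_n^k))\subset S$ be its edge ideal, and let $\operatorname{depth}(S/I(C_n^k))$ be the supremum of the lengths of the $S/I(C_n^k)$-regular sequences contained in the maximal graded ideal $(x_1,\dots,x_n)$ of $S$. If $n\le 2k+1$, then $\operatorname{depth}(S/I(C_n^k))=1$. If $n\ge 2k+2$, then $$\operatorname{depth}(S/I(C_n^k))=\left\lceil\frac{n}{2k+1}\right\rceil\quad\text{if } n\equiv 0,k+1,k+2,\dots,2k \pmod{2k+1},$$ $$\left\lceil\frac{n}{2k+1}\right\rceil-1\le \operatorname{depth}(S/I(C_n^k))\le \left\lceil\frac{n}{2k+1}\right\rceil\quad\text{if } n\equiv 1,\dots,k \pmod{2k+1}.$$ -/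

import Mathlib

/-- The `k`-th power of a simple graph: two distinct vertices are adjacent when their distance
in `G` is at most `k` (`SimpleGraph.edist` is the distance with value `⊤` on pairs of vertices
that are not joined by a walk). -/
def graphPower {V : Type*} (G : SimpleGraph V) (k : ℕ) : SimpleGraph V where
  Adj u v := u ≠ v ∧ G.edist u v ≤ (k : ℕ∞)
  symm := ⟨fun _ _ h => ⟨h.1.symm, by rw [SimpleGraph.edist_comm]; exact h.2⟩⟩
  loopless := ⟨fun _ h => h.1 rfl⟩

/-- The edge ideal `I(G) = (x_i x_j : {i, j} ∈ E(G))` of a simple graph `G` in the polynomial ring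
over `K` whose variables are the vertices of `G`. -/
noncomputable def edgeIdeal (K : Type*) [Field K] {V : Type*} (G : SimpleGraph V) : Ideal (MvPolynomial V K) :=
  Ideal.span {f | ∃ i j : V, G.Adj i j ∧ f = MvPolynomial.X i * MvPolynomial.X j}

/-- The depth of a module `M` with respect to an ideal `J`: the supremum of the lengths of
the `M`-regular sequences all of whose members lie in `J`. -/
noncomputable def idealDepth {R : Type*} [CommRing R] (J : Ideal R)
    (M : Type*) [AddCommGroup M] [Module R M] : ℕ∞ :=
  ⨆ (rs : List R) (_ : (∀ r ∈ rs, r ∈ J) ∧ RingTheory.Sequence.IsRegular M rs), (rs.length : ℕ∞)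

/-- The depth of `S / I(C_n^k)`, where `C_n` is the cycle on `n` vertices and
`S = K[x_1, …, x_n]`, as a module over `S` and
with respect to the maximal graded ideal
`(x_1, …, x_n)` of `S`. -/
noncomputable def depthCyclePower (K : Type*) [Field K] (n k : ℕ) : ℕ∞ :=
  idealDepth (MvPolynomial.idealOfVars (Fin n) K)
    (MvPolynomial (Fin n) K ⧸ edgeIdeal K (graphPower (SimpleGraph.cycleGraph n) k))

/-! Put d = 2k+1. Upper bound: an independent dominating set W makes the ideal P of variables
outside W an associated prime of S/I, and depth ≤ dim S/P = |W| (`idealDepth_le_ringKrullDim`). In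
C_n^k, ⌈n/d⌉ vertices spaced by d, the last pulled back if needed, form such a set. Lower bound: 0 →
S/(I : x_v) → S/I → S/(I, x_v) → 0 bounds depth below by the depths of its ends. On the colon side
the neighbours of v vanish and v, now isolated, adds one; on the other side v is deleted
(`InducedDepthGE.of_branch`). This gives ⌈m/d⌉ for path powers on m vertices. Deleting k consecutive
vertices of the cycle leaves a path power on n-k vertices, so the depth is at least ⌈(n-k)/d⌉. This
is ⌈n/d⌉ when n mod d is 0 or exceeds k, and one less otherwise. -/

/-! ### Depth and associated primes -/

open Pointwise in
/-- If `x` is a nonzerodivisor on `M` in a prime `𝔪` containing an associated prime `P` of `M`, then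
`P` is strictly contained in an associated prime of `M ⧸ x M` inside `𝔪`. -/
theorem exists_lt_isAssociatedPrime_quotSMulTop {R M : Type*} [CommRing R] [IsNoetherianRing R]
    [AddCommGroup M] [Module R M] [Module.Finite R M] {𝔪 P : Ideal R} [h𝔪 : 𝔪.IsPrime]
    (hP : IsAssociatedPrime P M) (hPm : P ≤ 𝔪) {x : R} (hx : x ∈ 𝔪) (hreg : IsSMulRegular M x) :
    ∃ Q : Ideal R, IsAssociatedPrime Q (QuotSMulTop x M) ∧ Q ≤ 𝔪 ∧ P < Q := by
  obtain ⟨hprime, y₀, hy₀⟩ := isAssociatedPrime_iff.mp hP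
  have hmem : ∀ r, r ∈ P ↔ r • y₀ = 0 := fun r => by
    rw [hy₀]; simp [Submodule.mem_colon_singleton]
  -- `N` is the part of `M` killed by `P`. It is supported at `𝔪`, hence so is `N/xN`, because `x ∈
  -- 𝔪`.
  let N : Submodule R M :=
    { carrier := {y | ∀ r ∈ P, r • y = 0}
      add_mem' := fun ha hb r hr => by rw [smul_add, ha r hr, hb r hr, add_zero]
      zero_mem' := fun r _ => smul_zero r
      smul_mem' := fun c y hy r hr => by rw [smul_comm, hy r hr, smul_zero] }
  have hsupp : (⟨𝔪, h𝔪⟩ : PrimeSpectrum R) ∈ Module.support R (QuotSMulTop x N) := by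
    rw [Module.support_quotSMulTop]
    refine ⟨?_, by simpa using hx⟩
    rw [Module.mem_support_iff']
    refine ⟨⟨y₀, fun r hr => (hmem r).1 hr⟩, fun r hr h => hr (hPm ((hmem r).2 ?_))⟩
    simpa using congrArg Subtype.val h
  rw [Module.mem_support_iff'] at hsupp
  obtain ⟨z, hz⟩ := hsupp
  obtain ⟨y, rfl⟩ := Submodule.Quotient.mk_surjective _ z
  have hy : ∀ r ∉ 𝔪, r • (Submodule.Quotient.mk (y : M) : QuotSMulTop x M) ≠ 0 := by
    intro r hr h
    apply hz r hr
    rw [← Submodule.Quotient.mk_smul, Submodule.Quotient.mk_eq_zero,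
      Submodule.mem_smul_pointwise_iff_exists] at h ⊢
    obtain ⟨w, -, hw⟩ := h
    -- Regularity of `x` gives `N ∩ xM = xN`, so `y` stays nonzero at `𝔪` in `M/xM`.
    have hwN : w ∈ N := fun s hs => hreg (by
      change x • s • w = x • 0
      rw [smul_comm, hw, smul_comm, y.2 s hs, smul_zero, smul_zero])
    exact ⟨⟨w, hwN⟩, trivial, Subtype.ext hw⟩
  set A : Submodule R (QuotSMulTop x M) := Submodule.span R {Submodule.Quotient.mk (y : M)}
  have hA : Module.annihilator R A ≤ 𝔪 := by
    intro r hr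
    by_contra hrm
    rw [Submodule.mem_annihilator] at hr
    exact hy r hrm (hr _ (Submodule.mem_span_singleton_self _))
  obtain ⟨Q, hQ, hQm⟩ := Ideal.exists_minimalPrimes_le hA
  have hQA := Module.associatedPrimes.minimalPrimes_annihilator_subset_associatedPrimes R A hQ
  have hle : ∀ r, r • (Submodule.Quotient.mk (y : M) : QuotSMulTop x M) = 0 → r ∈ Q := by
    intro r hr
    refine hQ.1.2 ?_
    rw [Submodule.mem_annihilator]
    intro a ha
    obtain ⟨c, rfl⟩ := Submodule.mem_span_singleton.1 ha
    rw [smul_comm, hr, smul_zero]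
  refine ⟨Q, IsAssociatedPrime.map_of_injective A.subtype hQA A.injective_subtype, hQm,
    lt_of_le_of_ne (fun r hr => hle r ?_) ?_⟩
  · rw [← Submodule.Quotient.mk_smul, y.2 r hr, Submodule.Quotient.mk_zero]
  -- `Q` contains `x`, which kills `M/xM`; were `Q = P`, the regular element `x` would kill `y₀`.
  · rintro rfl
    have hxP : x ∈ P := hle x (by
      rw [← Submodule.Quotient.mk_smul, Submodule.Quotient.mk_eq_zero]
      exact Submodule.smul_mem_pointwise_smul _ _ _ trivial)
    have h0 : y₀ = 0 := hreg (by simpa using (hmem x).1 hxP)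
    exact hprime.ne_top ((Ideal.eq_top_iff_one _).2 ((hmem 1).2 (by simp [h0])))

/-- Each member of the sequence pushes an associated prime strictly upwards, which builds a chain of
primes above `P`. -/
theorem length_le_coheight_of_isRegular {R : Type*} [CommRing R] [IsNoetherianRing R]
    {𝔪 : Ideal R} [h𝔪 : 𝔪.IsPrime] (rs : List R) (hrs : ∀ r ∈ rs, r ∈ 𝔪) {M : Type*}
    [AddCommGroup M] [Module R M] [Module.Finite R M] (hreg : RingTheory.Sequence.IsRegular M rs)
    {P : PrimeSpectrum R} (hP : IsAssociatedPrime P.asIdeal M) (hPm : P.asIdeal ≤ 𝔪) :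
    (rs.length : ℕ∞) ≤ Order.coheight P := by
  induction rs generalizing M P with
  | nil => simp
  | cons x rs ih =>
    rw [RingTheory.Sequence.isRegular_cons_iff] at hreg
    obtain ⟨Q, hQ, hQm, hlt⟩ := exists_lt_isAssociatedPrime_quotSMulTop hP hPm
      (hrs x List.mem_cons_self) hreg.1
    have h := ih (fun r hr => hrs r (List.mem_cons_of_mem _ hr)) hreg.2 (P := ⟨Q, hQ.isPrime⟩) hQ hQm
    push_cast [List.length_cons]
    exact (add_le_add_left h 1).trans (Order.coheight_add_one_le hlt)

/-- Depth is at most the dimension of the quotient by any associated prime. -/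
theorem idealDepth_le_ringKrullDim {R : Type*} [CommRing R] [IsNoetherianRing R]
    {𝔪 : Ideal R} [h𝔪 : 𝔪.IsPrime] {M : Type*} [AddCommGroup M] [Module R M] [Module.Finite R M]
    {P : Ideal R} (hP : IsAssociatedPrime P M) (hPm : P ≤ 𝔪) :
    (idealDepth 𝔪 M : WithBot ℕ∞) ≤ ringKrullDim (R ⧸ P) := by
  let p : PrimeSpectrum R := ⟨P, hP.isPrime⟩
  have h1 : idealDepth 𝔪 M ≤ Order.coheight p :=
    iSup₂_le fun rs hrs => length_le_coheight_of_isRegular rs hrs.1 hrs.2 hP hPm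
  refine (WithBot.coe_le_coe.2 h1).trans ?_
  rw [ringKrullDim_quotient, Order.coheight_eq_krullDim_Ici]
  exact le_of_eq rfl

/-! ### Lower bounds for depth through Ext -/

open CategoryTheory Abelian in
/-- Homological form of `depth M ≥ t` with respect to the ideal `𝔪`: the modules `Ext^i(R/𝔪, M)`
vanish for `i < t`. -/
def ExtVanishesBelow {R : Type*} [CommRing R] (𝔪 : Ideal R) (M : Type _) [AddCommGroup M]
    [Module R M] (t : ℕ) : Prop :=
  ∀ i < t, Subsingleton (Ext (ModuleCat.of R (R ⧸ 𝔪)) (ModuleCat.of R M) i)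

universe u v

section

variable {R : Type u} [CommRing R] {𝔪 : Ideal R}

theorem extVanishesBelow_zero (M : Type u) [AddCommGroup M] [Module R M] :
    ExtVanishesBelow 𝔪 M 0 := fun _ hi => absurd hi (Nat.not_lt_zero _)

open CategoryTheory Abelian Limits in
theorem ExtVanishesBelow.of_exact {A B C : Type u} [AddCommGroup A] [AddCommGroup B]
    [AddCommGroup C] [Module R A] [Module R B] [Module R C] {f : A →ₗ[R] B} {g : B →ₗ[R] C}
    (hf : Function.Injective f) (hfg : Function.Exact f g) (hg : Function.Surjective g) {t : ℕ}
    (hA : ExtVanishesBelow 𝔪 A t) (hC : ExtVanishesBelow 𝔪 C t) : ExtVanishesBelow 𝔪 B t := by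
  intro i hi
  let S : ShortComplex (ModuleCat.{u} R) :=
    ModuleCat.shortComplexOfCompEqZero f g hfg.linearMap_comp_eq_zero
  have hS : S.ShortExact := ModuleCat.shortComplex_shortExact S hfg hf hg
  have hA0 := AddCommGrpCat.isZero_of_iff_subsingleton.mpr (hA i hi)
  have hC0 := AddCommGrpCat.isZero_of_iff_subsingleton.mpr (hC i hi)
  exact AddCommGrpCat.subsingleton_of_isZero <| ShortComplex.Exact.isZero_of_both_zeros
    (Ext.covariant_sequence_exact₂' (ModuleCat.of R (R ⧸ 𝔪)) hS i)
    (hA0.eq_zero_of_src _) (hC0.eq_zero_of_tgt _)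

open CategoryTheory Abelian Limits in
-- Multiplication by `x` on `Ext^(i+1)(R/𝔪, M)` is injective because `Ext^i(R/𝔪, C)` vanishes, and
-- zero because `x` kills `R/𝔪`.
theorem ExtVanishesBelow.succ_of_exact {M C : Type u} [AddCommGroup M] [AddCommGroup C]
    [Module R M] [Module R C] {x : R} (hx : x ∈ 𝔪) (hreg : IsSMulRegular M x) {g : M →ₗ[R] C}
    (hfg : Function.Exact (LinearMap.lsmul R M x) g) (hg : Function.Surjective g) {t : ℕ}
    (hC : ExtVanishesBelow 𝔪 C t) : ExtVanishesBelow 𝔪 M (t + 1) := by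
  intro i hi
  have hann : x ∈ Module.annihilator R (R ⧸ 𝔪) := by rwa [Ideal.annihilator_quotient]
  match i with
  | 0 =>
    have : Subsingleton ((R ⧸ 𝔪) →ₗ[R] M) :=
      IsSMulRegular.linearMap_subsingleton_of_mem_annihilator hreg hann
    exact (Ext.addEquiv₀.trans ModuleCat.homAddEquiv).subsingleton
  | i + 1 =>
    let S : ShortComplex (ModuleCat.{u} R) :=
      ModuleCat.shortComplexOfCompEqZero (LinearMap.lsmul R M x) g hfg.linearMap_comp_eq_zero
    have hS : S.ShortExact := ModuleCat.shortComplex_shortExact S hfg hreg hg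
    have hC0 := AddCommGrpCat.isZero_of_iff_subsingleton.mpr (hC i (by omega))
    have hmono := (Ext.covariant_sequence_exact₁' (ModuleCat.of R (R ⧸ 𝔪)) hS i (i + 1) rfl).mono_g
      (hC0.eq_zero_of_src _)
    have hzero := Ext.postcomp_smul_id_eq_zero_of_mem_annihilator
      (N := ModuleCat.of R (R ⧸ 𝔪)) (M := ModuleCat.of R M) hann (i + 1)
    exact AddCommGrpCat.subsingleton_of_isZero (@IsZero.of_mono_eq_zero _ _ _ _ _ _ hmono hzero)

theorem Ideal.mem_sup_span_singleton_iff_exists_mul_sub_mem {I : Ideal R} {x f : R} :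
    f ∈ I ⊔ Ideal.span {x} ↔ ∃ c, x * c - f ∈ I := by
  rw [Submodule.mem_sup]
  constructor
  · rintro ⟨a, ha, z, hz, rfl⟩
    obtain ⟨c, rfl⟩ := Ideal.mem_span_singleton'.1 hz
    exact ⟨c, by simpa [mul_comm] using ha⟩
  · rintro ⟨c, hc⟩
    exact ⟨_, I.neg_mem hc, c * x, Ideal.mem_span_singleton'.2 ⟨c, rfl⟩, by ring⟩

/-- Uses 0 → R/(I : x) → R/I → R/(I, x) → 0. Taking `I'` separately lets the colon ideal be given by
explicit generators. -/
theorem ExtVanishesBelow.quotient_of_colon {I I' : Ideal R} {x : R}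
    (hI' : ∀ f, x * f ∈ I ↔ f ∈ I') {t : ℕ} (h₁ : ExtVanishesBelow 𝔪 (R ⧸ I') t)
    (h₂ : ExtVanishesBelow 𝔪 (R ⧸ I ⊔ Ideal.span {x}) t) : ExtVanishesBelow 𝔪 (R ⧸ I) t := by
  have hle : I' ≤ Submodule.comap (LinearMap.lsmul R R x) I := fun f hf => (hI' f).2 hf
  refine ExtVanishesBelow.of_exact (f := Submodule.mapQ I' I (LinearMap.lsmul R R x) hle)
    (g := Submodule.factor le_sup_left) ?_ ?_ (Submodule.factor_surjective _) h₁ h₂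
  · rw [injective_iff_map_eq_zero]
    intro a ha
    obtain ⟨f, rfl⟩ := Submodule.Quotient.mk_surjective _ a
    exact (Submodule.Quotient.mk_eq_zero _).2 ((hI' f).1 ((Submodule.Quotient.mk_eq_zero _).1 ha))
  · intro b
    obtain ⟨f, rfl⟩ := Submodule.Quotient.mk_surjective _ b
    refine (Submodule.Quotient.mk_eq_zero _).trans
      (Ideal.mem_sup_span_singleton_iff_exists_mul_sub_mem.trans ?_)
    rw [Set.mem_range, (Submodule.Quotient.mk_surjective _).exists]
    exact exists_congr fun c => (Submodule.Quotient.eq I).symm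

theorem ExtVanishesBelow.quotient_succ {I : Ideal R} {x : R} (hx : x ∈ 𝔪)
    (hI : ∀ f, x * f ∈ I → f ∈ I) {t : ℕ}
    (h : ExtVanishesBelow 𝔪 (R ⧸ I ⊔ Ideal.span {x}) t) : ExtVanishesBelow 𝔪 (R ⧸ I) (t + 1) := by
  refine ExtVanishesBelow.succ_of_exact hx ((isSMulRegular_quotient_iff_mem_of_smul_mem _ _).2 hI)
    (g := Submodule.factor le_sup_left) ?_ (Submodule.factor_surjective _) h
  intro b
  obtain ⟨f, rfl⟩ := Submodule.Quotient.mk_surjective _ b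
  refine (Submodule.Quotient.mk_eq_zero _).trans
    (Ideal.mem_sup_span_singleton_iff_exists_mul_sub_mem.trans ?_)
  rw [Set.mem_range, (Submodule.Quotient.mk_surjective _).exists]
  exact exists_congr fun c => (Submodule.Quotient.eq I).symm

/-- The lower bound for the depth given by Rees' theorem. -/
theorem ExtVanishesBelow.le_idealDepth [IsNoetherianRing R] {M : Type u} [AddCommGroup M]
    [Module R M] [Module.Finite R M] (hM : 𝔪 • (⊤ : Submodule R M) < ⊤) {t : ℕ}
    (h : ExtVanishesBelow 𝔪 M t) : (t : ℕ∞) ≤ idealDepth 𝔪 M := by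
  obtain ⟨rs, rfl, hmem, hreg⟩ := ModuleCat.exists_isRegular_of_exists_subsingleton_ext 𝔪 t
    (ModuleCat.of R M) hM (ModuleCat.of R (R ⧸ 𝔪))
    (by rw [Module.support_eq_zeroLocus, Ideal.annihilator_quotient]) h
  exact le_iSup₂_of_le rs ⟨hmem, hreg⟩ le_rfl

end

/-! ### Edge ideals and independent dominating sets -/

open MvPolynomial

section

variable {K : Type*} [Field K] {V : Type*}

/-- Identifies the quotient by the variables outside `W` with the polynomial ring on `W`, which
yields both primality and dimension. -/
theorem killCompl_eq_zero_iff_mem_span_X (W : Set V) (f : MvPolynomial V K) :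
    killCompl (Subtype.val_injective (p := (· ∈ W))) f = 0 ↔
      f ∈ Ideal.span (X '' Wᶜ : Set (MvPolynomial V K)) := by
  constructor
  · intro hf
    have h : ((Ideal.Quotient.mkₐ K (Ideal.span (X '' Wᶜ : Set (MvPolynomial V K)))).comp
        (rename Subtype.val)).comp (killCompl (Subtype.val_injective (p := (· ∈ W)))) =
          Ideal.Quotient.mkₐ K _ := by
      refine algHom_ext fun i => ?_
      by_cases hi : i ∈ W
      · have := killCompl_rename_app (R := K) (Subtype.val_injective (p := (· ∈ W))) (X ⟨i, hi⟩)
        rw [rename_X] at this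
        simp [this]
      · have : killCompl (R := K) (Subtype.val_injective (p := (· ∈ W))) (X i) = 0 := by
          simp [killCompl, hi]
        simp only [AlgHom.comp_apply, this, map_zero]
        exact (Ideal.Quotient.eq_zero_iff_mem.2 (Ideal.subset_span (Set.mem_image_of_mem X hi))).symm
    have := DFunLike.congr_fun h f
    simp only [AlgHom.comp_apply, hf, map_zero] at this
    exact Ideal.Quotient.eq_zero_iff_mem.1 this.symm
  · intro hf
    have hle : Ideal.span (X '' Wᶜ : Set (MvPolynomial V K)) ≤
        RingHom.ker (killCompl (R := K) (Subtype.val_injective (p := (· ∈ W)))) := by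
      rw [Ideal.span_le]
      rintro _ ⟨i, hi, rfl⟩
      have hi' : i ∉ W := hi
      simp [RingHom.mem_ker, killCompl, hi']
    exact hle hf

theorem span_X_eq_ker_killCompl (W : Set V) :
    Ideal.span (X '' Wᶜ : Set (MvPolynomial V K)) =
      RingHom.ker (killCompl (R := K) (Subtype.val_injective (p := (· ∈ W)))) :=
  Ideal.ext fun f => (killCompl_eq_zero_iff_mem_span_X W f).symm

theorem isPrime_span_X (W : Set V) : (Ideal.span (X '' Wᶜ : Set (MvPolynomial V K))).IsPrime := by
  rw [span_X_eq_ker_killCompl]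
  exact RingHom.ker_isPrime _

theorem isPrime_idealOfVars : (idealOfVars V K).IsPrime := by
  simpa using isPrime_span_X (K := K) (∅ : Set V)

theorem ringKrullDim_quotient_span_X_le [Finite V] (W : Set V) :
    ringKrullDim (MvPolynomial V K ⧸ Ideal.span (X '' Wᶜ : Set (MvPolynomial V K))) ≤
      W.ncard := by
  have hsurj : Function.Surjective (killCompl (R := K) (Subtype.val_injective (p := (· ∈ W)))) :=
    fun f => ⟨_, killCompl_rename_app _ f⟩
  rw [span_X_eq_ker_killCompl, ringKrullDim_eq_of_ringEquiv
    (Ideal.quotientKerAlgEquivOfSurjective hsurj).toRingEquiv,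
    MvPolynomial.ringKrullDim_of_isNoetherianRing, ringKrullDim_eq_zero_of_field, zero_add]
  exact le_of_eq rfl

theorem edgeIdeal_le_span_X_compl {G : SimpleGraph V} {W : Set V} (hW : G.IsIndepSet W) :
    edgeIdeal K G ≤ Ideal.span (X '' Wᶜ) := by
  refine Ideal.span_le.2 ?_
  rintro _ ⟨i, j, hij, rfl⟩
  by_cases hi : i ∈ W
  · have hj : j ∉ W := fun hj => hW hi hj hij.ne hij
    exact Ideal.mul_mem_left _ _ (Ideal.subset_span ⟨j, hj, rfl⟩)
  · exact Ideal.mul_mem_right _ _ (Ideal.subset_span ⟨i, hi, rfl⟩)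

/-- An independent dominating set gives an associated prime of the edge ideal. -/
theorem isAssociatedPrime_span_X_compl [Finite V] {G : SimpleGraph V} {W : Finset V}
    (hW : G.IsIndepSet (W : Set V)) (hdom : ∀ v ∉ W, ∃ w ∈ W, G.Adj v w) :
    IsAssociatedPrime (Ideal.span (X '' (W : Set V)ᶜ : Set (MvPolynomial V K)))
      (MvPolynomial V K ⧸ edgeIdeal K G) := by
  rw [isAssociatedPrime_iff]
  -- Domination makes each variable outside `W` kill this class. Conversely, independence puts the
  -- edge ideal inside the prime, which does not contain the product.
  refine ⟨isPrime_span_X _, Ideal.Quotient.mk _ (∏ w ∈ W, X w), ?_⟩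
  have hP := isPrime_span_X (K := K) (W : Set V)
  ext f
  rw [Submodule.mem_colon_singleton, Submodule.mem_bot]
  change _ ↔ Ideal.Quotient.mk (edgeIdeal K G) (f * ∏ w ∈ W, X w) = 0
  rw [Ideal.Quotient.eq_zero_iff_mem]
  constructor
  · intro hf
    have hle : Ideal.span (X '' (W : Set V)ᶜ) ≤
        (edgeIdeal K G).colon {∏ w ∈ W, (X w : MvPolynomial V K)} := by
      refine Ideal.span_le.2 ?_
      rintro _ ⟨v, hv, rfl⟩
      obtain ⟨w, hw, hvw⟩ := hdom v hv
      rw [SetLike.mem_coe, Submodule.mem_colon_singleton, smul_eq_mul]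
      refine Ideal.mem_of_dvd _ (mul_dvd_mul_left (X v) (Finset.dvd_prod_of_mem _ hw)) ?_
      exact Ideal.subset_span ⟨v, w, hvw, rfl⟩
    exact Submodule.mem_colon_singleton.1 (hle hf)
  · intro hf
    refine (hP.mem_or_mem (edgeIdeal_le_span_X_compl hW hf)).resolve_right fun h => ?_
    obtain ⟨w, hw, hmem⟩ := (hP.prod_mem_iff).1 h
    rw [← killCompl_eq_zero_iff_mem_span_X] at hmem
    have := killCompl_rename_app (R := K) (Subtype.val_injective (p := (· ∈ (W : Set V))))
      (X ⟨w, hw⟩)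
    rw [rename_X] at this
    exact X_ne_zero _ (this.symm.trans hmem)

theorem idealDepth_edgeIdeal_le_card [Finite V] {G : SimpleGraph V} {W : Finset V}
    (hW : G.IsIndepSet (W : Set V)) (hdom : ∀ v ∉ W, ∃ w ∈ W, G.Adj v w) :
    idealDepth (idealOfVars V K) (MvPolynomial V K ⧸ edgeIdeal K G) ≤ W.card := by
  have := isPrime_idealOfVars (K := K) (V := V)
  have h := (idealDepth_le_ringKrullDim (isAssociatedPrime_span_X_compl (K := K) hW hdom)
    (Ideal.span_mono (Set.image_subset_range _ _))).trans (ringKrullDim_quotient_span_X_le _)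
  rw [Set.ncard_coe_finset] at h
  exact WithBot.coe_le_coe.1 h

/-! ### Vertex deletion and colon ideals -/

/-- The edge ideal of the subgraph induced on `U`, enlarged by the variables outside `U`. -/
noncomputable def inducedEdgeIdeal (K : Type*) [Field K] {V : Type*} (G : SimpleGraph V)
    (U : Set V) : Ideal (MvPolynomial V K) :=
  edgeIdeal K G ⊔ Ideal.span (X '' Uᶜ)

variable {G : SimpleGraph V}

/-- The ideal is monomial, so membership is decided on each monomial of the support. -/
theorem mem_inducedEdgeIdeal {U : Set V} {f : MvPolynomial V K} :
    f ∈ inducedEdgeIdeal K G U ↔ ∀ m ∈ f.support,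
      (∃ i j, G.Adj i j ∧ m i ≠ 0 ∧ m j ≠ 0) ∨ ∃ i ∉ U, m i ≠ 0 := by
  classical
  have hspan : inducedEdgeIdeal K G U = Ideal.span ((fun s => monomial s (1 : K)) ''
      ({s | ∃ i j, G.Adj i j ∧ s = Finsupp.single i 1 + Finsupp.single j 1} ∪
        {s | ∃ i ∉ U, s = Finsupp.single i 1})) := by
    rw [Set.image_union, Ideal.span_union, inducedEdgeIdeal, edgeIdeal]
    congr 2
    · ext f
      constructor
      · rintro ⟨i, j, hij, rfl⟩
        exact ⟨_, ⟨i, j, hij, rfl⟩, by simp [X, monomial_mul]⟩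
      · rintro ⟨_, ⟨i, j, hij, rfl⟩, rfl⟩
        exact ⟨i, j, hij, by simp [X, monomial_mul]⟩
    · ext f
      constructor
      · rintro ⟨i, hi, rfl⟩
        exact ⟨_, ⟨i, hi, rfl⟩, rfl⟩
      · rintro ⟨_, ⟨i, hi, rfl⟩, rfl⟩
        exact ⟨i, hi, rfl⟩
  rw [hspan, mem_ideal_span_monomial_image]
  refine forall₂_congr fun m _ => ⟨?_, ?_⟩
  · rintro ⟨s, ⟨i, j, hij, rfl⟩ | ⟨i, hi, rfl⟩, hs⟩
    · refine Or.inl ⟨i, j, hij, ?_, ?_⟩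
      · have := hs i
        simp [hij.ne] at this
        omega
      · have := hs j
        simp [hij.ne'] at this
        omega
    · refine Or.inr ⟨i, hi, ?_⟩
      have := hs i
      simp at this
      omega
  · rintro (⟨i, j, hij, h₁, h₂⟩ | ⟨i, hi, h₁⟩)
    · refine ⟨_, Or.inl ⟨i, j, hij, rfl⟩, fun l => ?_⟩
      have := hij.ne
      simp only [Finsupp.add_apply, Finsupp.single_apply]
      split_ifs <;> grind
    · refine ⟨_, Or.inr ⟨i, hi, rfl⟩, fun l => ?_⟩
      simp only [Finsupp.single_apply]
      split_ifs <;> grind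

theorem inducedEdgeIdeal_univ : inducedEdgeIdeal K G Set.univ = edgeIdeal K G := by
  simp [inducedEdgeIdeal]

theorem inducedEdgeIdeal_anti {U U' : Set V} (h : U' ⊆ U) :
    inducedEdgeIdeal K G U ≤ inducedEdgeIdeal K G U' :=
  sup_le_sup_left (Ideal.span_mono (Set.image_mono (Set.compl_subset_compl.2 h))) _

theorem inducedEdgeIdeal_sup_span_X (U : Set V) (v : V) :
    inducedEdgeIdeal K G U ⊔ Ideal.span {X v} = inducedEdgeIdeal K G (U \ {v}) := by
  rw [inducedEdgeIdeal, inducedEdgeIdeal, sup_assoc, ← Ideal.span_union, ← Set.image_singleton,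
    ← Set.image_union, Set.sdiff_eq, Set.compl_inter, compl_compl]

theorem mem_inducedEdgeIdeal_of_X_mul_mem {U : Set V} {v : V} (hv : v ∈ U)
    (hU : ∀ w ∈ U, ¬ G.Adj v w) {f : MvPolynomial V K} (hf : X v * f ∈ inducedEdgeIdeal K G U) :
    f ∈ inducedEdgeIdeal K G U := by
  classical
  rw [mem_inducedEdgeIdeal] at hf ⊢
  intro m hm
  have h := hf (Finsupp.single v 1 + m) (by
    rw [mem_support_iff, coeff_X_mul]
    exact mem_support_iff.1 hm)
  have key : ∀ i, i ≠ v → (Finsupp.single v 1 + m : V →₀ ℕ) i ≠ 0 → m i ≠ 0 := by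
    intro i hi h
    simpa [Finsupp.single_apply, hi.symm] using h
  rcases h with ⟨i, j, hij, h₁, h₂⟩ | ⟨i, hi, h₁⟩
  · by_cases hiv : i = v
    · subst hiv
      exact Or.inr ⟨j, fun hj => hU j hj hij, key j hij.ne' h₂⟩
    by_cases hjv : j = v
    · subst hjv
      exact Or.inr ⟨i, fun hi => hU i hi hij.symm, key i hij.ne h₁⟩
    exact Or.inl ⟨i, j, hij, key i hiv h₁, key j hjv h₂⟩
  · exact Or.inr ⟨i, hi, key i (fun h => hi (h ▸ hv)) h₁⟩

/-- Neighbours of `v` lie in the colon ideal because of their edges to `v`. Once they are removed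
`v` is isolated, so `X v` is a nonzerodivisor and nothing more enters. -/
theorem X_mul_mem_inducedEdgeIdeal_iff {U : Set V} {v : V} (hv : v ∈ U) (f : MvPolynomial V K) :
    X v * f ∈ inducedEdgeIdeal K G U ↔ f ∈ inducedEdgeIdeal K G (U \ G.neighborSet v) := by
  constructor
  · intro hf
    exact mem_inducedEdgeIdeal_of_X_mul_mem (U := U \ G.neighborSet v) ⟨hv, by simp⟩ (fun w hw h => hw.2 h)
      (inducedEdgeIdeal_anti Set.sdiff_subset hf)
  · intro hf
    have hle : inducedEdgeIdeal K G (U \ G.neighborSet v) ≤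
        (inducedEdgeIdeal K G U).colon {(X v : MvPolynomial V K)} := by
      refine sup_le (fun g hg => ?_) (Ideal.span_le.2 ?_)
      · rw [Submodule.mem_colon_singleton]
        exact Ideal.mul_mem_right _ _ (Ideal.mem_sup_left hg)
      · rintro _ ⟨w, hw, rfl⟩
        rw [SetLike.mem_coe, Submodule.mem_colon_singleton, smul_eq_mul]
        by_cases hwU : w ∈ U
        · have hvw : G.Adj v w := by
            by_contra h
            exact hw ⟨hwU, h⟩
          exact Ideal.mem_sup_left (Ideal.subset_span ⟨w, v, hvw.symm, rfl⟩)
        · exact Ideal.mul_mem_right _ _ (Ideal.mem_sup_right (Ideal.subset_span ⟨w, hwU, rfl⟩))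
    have := Submodule.mem_colon_singleton.1 (hle hf)
    rwa [smul_eq_mul, mul_comm] at this

end

/-- Homological form of `depth K[U]/I(G[U]) ≥ t` for the subgraph of `G` induced on `U`. -/
def InducedDepthGE (K : Type u) [Field K] {V : Type v} (G : SimpleGraph V) (U : Set V) (t : ℕ) :
    Prop :=
  ExtVanishesBelow (idealOfVars V K) (MvPolynomial V K ⧸ inducedEdgeIdeal K G U) t

section

variable {K : Type u} [Field K] {V : Type v} {G : SimpleGraph V}

theorem inducedDepthGE_zero (U : Set V) : InducedDepthGE K G U 0 := extVanishesBelow_zero _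

theorem InducedDepthGE.of_delete {U : Set V} {v : V} (hv : v ∈ U) {t : ℕ}
    (h₁ : InducedDepthGE K G (U \ G.neighborSet v) t) (h₂ : InducedDepthGE K G (U \ {v}) t) :
    InducedDepthGE K G U t := by
  refine ExtVanishesBelow.quotient_of_colon (X_mul_mem_inducedEdgeIdeal_iff hv) h₁ ?_
  rwa [inducedEdgeIdeal_sup_span_X]

theorem InducedDepthGE.succ_of_isolated {U : Set V} {v : V} (hv : v ∈ U)
    (hU : ∀ w ∈ U, ¬ G.Adj v w) {t : ℕ} (h : InducedDepthGE K G (U \ {v}) t) :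
    InducedDepthGE K G U (t + 1) := by
  refine ExtVanishesBelow.quotient_succ (x := X v) (Ideal.subset_span (Set.mem_range_self v))
    (fun f => mem_inducedEdgeIdeal_of_X_mul_mem hv hU) ?_
  rwa [inducedEdgeIdeal_sup_span_X]

/-- The two branches at a vertex `v`: delete the closed neighbourhood of `v`, gaining one, or
delete `v`. -/
theorem InducedDepthGE.of_branch {U : Set V} {v : V} (hv : v ∈ U) {t : ℕ}
    (h₁ : InducedDepthGE K G (U \ insert v (G.neighborSet v)) t)
    (h₂ : InducedDepthGE K G (U \ {v}) (t + 1)) : InducedDepthGE K G U (t + 1) := by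
  refine InducedDepthGE.of_delete hv (InducedDepthGE.succ_of_isolated
    (U := U \ G.neighborSet v) ⟨hv, by simp⟩ (fun w hw h => hw.2 h) ?_) h₂
  rwa [Set.sdiff_sdiff, Set.union_singleton]

theorem InducedDepthGE.le_idealDepth [Finite V] {t : ℕ} (h : InducedDepthGE K G Set.univ t) :
    (t : ℕ∞) ≤ idealDepth (idealOfVars V K) (MvPolynomial V K ⧸ edgeIdeal K G) := by
  rw [InducedDepthGE, inducedEdgeIdeal_univ] at h
  refine h.le_idealDepth (lt_top_iff_ne_top.2 fun htop => ?_)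
  have hle : edgeIdeal K G ≤ idealOfVars V K := by
    refine (edgeIdeal_le_span_X_compl (W := ∅) (by simp [SimpleGraph.IsIndepSet])).trans ?_
    simp
  have h1 : (Ideal.Quotient.mk (edgeIdeal K G) 1) ∈
      idealOfVars V K • (⊤ : Submodule (MvPolynomial V K) (MvPolynomial V K ⧸ edgeIdeal K G)) :=
    htop.symm ▸ Submodule.mem_top
  have hmap : idealOfVars V K • (⊤ : Submodule (MvPolynomial V K) (MvPolynomial V K ⧸ edgeIdeal K G))
      ≤ Submodule.map (edgeIdeal K G).mkQ (idealOfVars V K) := by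
    refine Submodule.smul_le.2 fun r hr x _ => ?_
    obtain ⟨y, rfl⟩ := Submodule.Quotient.mk_surjective _ x
    exact ⟨r * y, Ideal.mul_mem_right _ _ hr, rfl⟩
  obtain ⟨y, hy, hy1⟩ := hmap h1
  have hsub := hle ((Submodule.Quotient.eq _).1 hy1)
  apply (isPrime_idealOfVars (K := K) (V := V)).ne_top
  rw [Ideal.eq_top_iff_one]
  simpa using (idealOfVars V K).sub_mem hy hsub

end

/-! ### Distances in the cycle -/

section

theorem SimpleGraph.cycleGraph_adj_iff_val {n : ℕ} (hn : 2 ≤ n) {u v : Fin n} :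
    (SimpleGraph.cycleGraph n).Adj u v ↔ u.val + 1 = v.val ∨ v.val + 1 = u.val ∨
      (u.val = 0 ∧ v.val + 1 = n) ∨ (v.val = 0 ∧ u.val + 1 = n) := by
  have hu := u.isLt
  have hv := v.isLt
  have key : ∀ a b : Fin n, (a - b).val = 1 ↔ b.val + 1 = a.val ∨ (a.val = 0 ∧ b.val + 1 = n) := by
    intro a b
    have ha := a.isLt
    have hb := b.isLt
    rw [Fin.val_sub]
    rcases lt_or_ge (n - b.val + a.val) n with h | h
    · rw [Nat.mod_eq_of_lt h]
      omega
    · rw [Nat.mod_eq_sub_mod h, Nat.mod_eq_of_lt (by omega)]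
      omega
  rw [SimpleGraph.cycleGraph_adj', key, key]
  omega

/-- The walk is at least as long as one of the two arcs between its ends; stated without subtraction
to keep the induction linear. -/
theorem cycleGraph_walk_length {n : ℕ} (hn : 2 ≤ n) {u v : Fin n}
    (p : (SimpleGraph.cycleGraph n).Walk u v) :
    (u.val ≤ v.val + p.length ∧ v.val ≤ u.val + p.length) ∨
      n + u.val ≤ v.val + p.length ∨ n + v.val ≤ u.val + p.length := by
  induction p with
  | nil => simp
  | cons h p ih =>
    rw [SimpleGraph.cycleGraph_adj_iff_val hn] at h
    rw [SimpleGraph.Walk.length_cons]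
    omega

theorem cycleGraph_edist_le_sub {n : ℕ} (hn : 2 ≤ n) (u : Fin n) (l : ℕ) :
    ∀ v : Fin n, v.val = u.val + l → (SimpleGraph.cycleGraph n).edist u v ≤ l := by
  induction l with
  | zero =>
    intro v hv
    obtain rfl : v = u := Fin.ext hv
    simp
  | succ l ih =>
    intro v hv
    have hlt := v.isLt
    let w : Fin n := ⟨u.val + l, by omega⟩
    have hadj : (SimpleGraph.cycleGraph n).Adj w v := by
      rw [SimpleGraph.cycleGraph_adj_iff_val hn]
      exact Or.inl hv.symm
    calc (SimpleGraph.cycleGraph n).edist u v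
        ≤ (SimpleGraph.cycleGraph n).edist u w + (SimpleGraph.cycleGraph n).edist w v :=
          SimpleGraph.edist_triangle
      _ ≤ l + 1 := add_le_add (ih w rfl) (SimpleGraph.edist_eq_one_iff_adj.2 hadj).le
      _ = ((l + 1 : ℕ) : ℕ∞) := by push_cast; rfl

theorem graphPower_cycleGraph_adj_of_lt {n : ℕ} (hn : 2 ≤ n) (k : ℕ) {u v : Fin n} (huv : u < v) :
    (graphPower (SimpleGraph.cycleGraph n) k).Adj u v ↔
      v.val - u.val ≤ k ∨ n - (v.val - u.val) ≤ k := by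
  have hlt : u.val < v.val := huv
  have hu := u.isLt
  have hv := v.isLt
  constructor
  · rintro ⟨-, h⟩
    obtain ⟨p, hp⟩ := SimpleGraph.exists_walk_of_edist_ne_top
      (ne_top_of_le_ne_top (ENat.natCast_ne_top k) h)
    rw [← hp, Nat.cast_le] at h
    have := cycleGraph_walk_length hn p
    omega
  · intro h
    refine ⟨huv.ne, ?_⟩
    rcases h with h | h
    · exact (cycleGraph_edist_le_sub hn u (v.val - u.val) v (by omega)).trans (Nat.cast_le.2 h)
    -- The other arc runs from `u` down to 0, across to `n - 1`, then down to `v`.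
    · let z : Fin n := ⟨0, by omega⟩
      let l : Fin n := ⟨n - 1, by omega⟩
      have h₁ : (SimpleGraph.cycleGraph n).edist u z ≤ (u.val : ℕ) := by
        rw [SimpleGraph.edist_comm]
        exact cycleGraph_edist_le_sub hn z u.val u (by simp [z])
      have h₂ : (SimpleGraph.cycleGraph n).edist z l ≤ (1 : ℕ) := by
        have hadj : (SimpleGraph.cycleGraph n).Adj z l := by
          rw [SimpleGraph.cycleGraph_adj_iff_val hn]
          exact Or.inr (Or.inr (Or.inl ⟨rfl, by simp only [l]; omega⟩))
        exact (SimpleGraph.edist_eq_one_iff_adj.2 hadj).le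
      have h₃ : (SimpleGraph.cycleGraph n).edist l v ≤ (n - 1 - v.val : ℕ) := by
        rw [SimpleGraph.edist_comm]
        exact cycleGraph_edist_le_sub hn v _ l (by simp only [l]; omega)
      have h₄ := SimpleGraph.edist_triangle.trans (add_le_add
        (SimpleGraph.edist_triangle.trans (add_le_add h₁ h₂)) h₃)
      refine h₄.trans ?_
      rw [← Nat.cast_add, ← Nat.cast_add, Nat.cast_le]
      omega

/-! ### Depth bounds for powers of paths and cycles -/

variable {K : Type u} [Field K] {n k : ℕ} {G : SimpleGraph (Fin n)}

/-- The lower bound `⌈m / (2k+1)⌉` for the depth of the `k`-th power of a path on the `m` vertices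
of the interval `[a, b)`. -/
theorem inducedDepthGE_interval {a₀ b : ℕ} (hb : b ≤ n)
    (hG : ∀ i j : Fin n, a₀ ≤ i.val → i < j → j.val < b → (G.Adj i j ↔ j.val - i.val ≤ k))
    (t a : ℕ) (ha : a₀ ≤ a) (ht : t * (2 * k + 1) < (b - a) + (2 * k + 1)) :
    InducedDepthGE K G {i | a ≤ i.val ∧ i.val < b} t := by
  induction t generalizing a with
  | zero => exact inducedDepthGE_zero _
  | succ t ih =>
    rw [Nat.add_mul, one_mul] at ht
    -- These sets arise by deleting `a + k`, `a + k - 1`, …, `a + j`. At `j = 1` the vertex `a` is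
    -- isolated; the colon branch at `a + j` removes everything up to `a + j + k`. Either way an
    -- interval shorter by at most `2k + 1` is left.
    have hU : ∀ j, 1 ≤ j → j ≤ k + 1 → a + j ≤ b → InducedDepthGE K G
        {i | (a ≤ i.val ∧ i.val < a + j) ∨ (a + k + 1 ≤ i.val ∧ i.val < b)} (t + 1) := by
      intro j hj
      induction j, hj using Nat.le_induction with
      | base =>
        intro _ hab
        obtain ⟨v, hv⟩ : ∃ v : Fin n, v.val = a := ⟨⟨a, by omega⟩, rfl⟩
        refine InducedDepthGE.succ_of_isolated (v := v) (Or.inl (by omega)) ?_ ?_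
        · rintro w (hw | hw) hadj
          · exact hadj.ne (Fin.ext (by omega))
          · have := (hG v w (by omega) (Fin.lt_def.2 (by omega)) hw.2).1 hadj
            omega
        · convert ih (a + k + 1) (by omega) (by omega) using 1
          ext i
          simp only [Set.mem_sdiff, Set.mem_ofPred_eq, Set.mem_singleton_iff, Fin.ext_iff]
          omega
      | succ j hj ihj =>
        intro hjk hab
        obtain ⟨v, hv⟩ : ∃ v : Fin n, v.val = a + j := ⟨⟨a + j, by omega⟩, rfl⟩
        refine InducedDepthGE.of_branch (v := v) (Or.inl (by omega)) ?_ ?_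
        · convert ih (a + j + k + 1) (by omega) (by omega) using 1
          ext i
          simp only [Set.mem_sdiff, Set.mem_ofPred_eq, Set.mem_insert_iff,
            SimpleGraph.mem_neighborSet]
          rcases lt_trichotomy v i with h | h | h
          · have hlt := Fin.lt_def.1 h
            by_cases hib : i.val < b
            · rw [hG v i (by omega) h hib, eq_false h.ne', false_or]
              omega
            · omega
          · subst h
            simp only [true_or, not_true_eq_false, and_false, false_iff]
            omega
          · have hlt := Fin.lt_def.1 h
            by_cases hia : a ≤ i.val
            · rw [SimpleGraph.adj_comm, hG i v (ha.trans hia) h (by omega)]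
              omega
            · omega
        · convert ihj (by omega) (by omega) using 1
          ext i
          simp only [Set.mem_sdiff, Set.mem_ofPred_eq, Set.mem_singleton_iff, Fin.ext_iff]
          omega
    -- The minimum covers intervals with fewer than `k + 1` vertices.
    convert hU (min (k + 1) (b - a)) (by omega) (by omega) (by omega) using 1
    ext i
    simp only [Set.mem_ofPred_eq]
    omega

/-- The hypothesis `ht` says `t ≤ ⌈(n - k)/(2k + 1)⌉`. Vertices 0, …, `k - 1` are deleted in turn;
on what remains no edge wraps around. -/
theorem inducedDepthGE_graphPower_cycleGraph (hn : 2 ≤ n) (hkn : k < n) {t : ℕ}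
    (ht : t * (2 * k + 1) < (n - k) + (2 * k + 1)) :
    InducedDepthGE K (graphPower (SimpleGraph.cycleGraph n) k) Set.univ t := by
  cases t with
  | zero => exact inducedDepthGE_zero _
  | succ t =>
    have hU : ∀ i ≤ k, InducedDepthGE K (graphPower (SimpleGraph.cycleGraph n) k)
        {x | k - i ≤ x.val ∧ x.val < n} (t + 1) := by
      intro i
      induction i with
      | zero =>
        intro _
        refine inducedDepthGE_interval (k := k) le_rfl (a₀ := k) (fun x y hx hxy hy => ?_) _ _
          le_rfl ht
        rw [graphPower_cycleGraph_adj_of_lt hn k hxy]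
        omega
      | succ i ih =>
        intro hik
        obtain ⟨v, hv⟩ : ∃ v : Fin n, v.val = k - (i + 1) := ⟨⟨k - (i + 1), by omega⟩, rfl⟩
        rw [Nat.add_mul, one_mul] at ht
        refine InducedDepthGE.of_branch (v := v) (show _ ∧ _ from ⟨hv.ge, v.isLt⟩) ?_ ?_
        -- The closed neighbourhood of `v` also wraps round to the labels from `n + v - k` on; the
        -- interval left is too short for edges that wrap.
        · convert inducedDepthGE_interval (K := K) (k := k) (a₀ := v.val + k + 1)
            (b := n + v.val - k) (G := graphPower (SimpleGraph.cycleGraph n) k) (by omega)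
            (fun x y hx hxy hy => ?_) t _ le_rfl (by omega) using 1
          · ext x
            have hx := x.isLt
            simp only [Set.mem_sdiff, Set.mem_ofPred_eq, Set.mem_insert_iff,
              SimpleGraph.mem_neighborSet]
            rcases lt_trichotomy v x with h | h | h
            · have hlt := Fin.lt_def.1 h
              rw [graphPower_cycleGraph_adj_of_lt hn k h, eq_false h.ne', false_or]
              omega
            · subst h
              simp only [true_or, not_true_eq_false, and_false, false_iff]
              omega
            · have hlt := Fin.lt_def.1 h
              omega
          · rw [graphPower_cycleGraph_adj_of_lt hn k hxy]
            omega
        · convert ih (by omega) using 1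
          ext x
          simp only [Set.mem_sdiff, Set.mem_ofPred_eq, Set.mem_singleton_iff, Fin.ext_iff]
          omega
    convert hU k le_rfl using 1
    ext x
    simp

theorem le_depthCyclePower (hn : 2 ≤ n) (hkn : k < n) {t : ℕ}
    (ht : t * (2 * k + 1) < (n - k) + (2 * k + 1)) : (t : ℕ∞) ≤ depthCyclePower K n k :=
  (inducedDepthGE_graphPower_cycleGraph hn hkn ht).le_idealDepth

theorem one_le_depthCyclePower (hn : 2 ≤ n) : 1 ≤ depthCyclePower K n k := by
  rcases lt_or_ge k n with hkn | hkn
  · exact_mod_cast le_depthCyclePower (K := K) (t := 1) hn hkn (by omega)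
  -- Here all labels differ by less than `k`, so the whole cycle power is already a path power.
  · refine InducedDepthGE.le_idealDepth (t := 1) ?_
    convert inducedDepthGE_interval (K := K) (k := k) (a₀ := 0) (b := n)
      (G := graphPower (SimpleGraph.cycleGraph n) k) le_rfl (fun x y _ hxy _ => ?_) 1 0 le_rfl
      (by omega) using 1
    · ext x
      simp
    · rw [graphPower_cycleGraph_adj_of_lt hn k hxy]
      omega

/-- The upper bound from an independent dominating set with consecutive gaps between `k + 1` and
`2k + 1`. -/
theorem depthCyclePower_le (hn : 2 ≤ n) {m : ℕ} (hm : 1 ≤ m) (hlt : (m - 1) * (2 * k + 1) < n)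
    (hle : n ≤ m * (2 * k + 1)) : depthCyclePower K n k ≤ m := by
  obtain ⟨d, hd⟩ : ∃ d, d = 2 * k + 1 := ⟨_, rfl⟩
  rw [← hd] at hlt hle
  obtain ⟨m, rfl⟩ : ∃ l, m = l + 1 := ⟨m - 1, by omega⟩
  rw [Nat.add_sub_cancel] at hlt
  rw [Nat.add_mul, one_mul] at hle
  have hpos : ∀ j ≤ m, min (j * d) (n - k - 1) < n := fun j hj => by omega
  -- The cap `n - k - 1` affects only the last point and keeps it at distance at least `k + 1` from
  -- 0 around the cycle.
  let p : Fin (m + 1) → Fin n := fun j =>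
    ⟨min (j.val * d) (n - k - 1), hpos _ (Nat.le_of_lt_succ j.isLt)⟩
  have hsep : ∀ a b : Fin (m + 1), a < b →
      p a < p b ∧ ¬ (graphPower (SimpleGraph.cycleGraph n) k).Adj (p a) (p b) := by
    intro a b hab
    have h₁ : (a.val + 1) * d ≤ b.val * d := Nat.mul_le_mul_right d hab
    have h₂ : b.val * d ≤ m * d := Nat.mul_le_mul_right d (Nat.le_of_lt_succ b.isLt)
    rw [Nat.add_mul, one_mul] at h₁
    have hlt' : p a < p b := Fin.lt_def.2 (by simp only [p]; omega)
    refine ⟨hlt', ?_⟩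
    rw [graphPower_cycleGraph_adj_of_lt hn k hlt']
    simp only [p]
    omega
  have hnear : ∀ v w : Fin n, v ≠ w →
      (v.val ≤ w.val + k ∧ w.val ≤ v.val + k ∨ n + w.val ≤ v.val + k) →
        (graphPower (SimpleGraph.cycleGraph n) k).Adj v w := by
    intro v w hvw h
    have hv := v.isLt
    have hw := w.isLt
    rcases lt_or_gt_of_ne hvw with hlt | hlt
    · rw [graphPower_cycleGraph_adj_of_lt hn k hlt]
      omega
    · rw [SimpleGraph.adj_comm, graphPower_cycleGraph_adj_of_lt hn k hlt]
      omega
  refine (idealDepth_edgeIdeal_le_card (W := Finset.univ.image p) ?_ ?_).trans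
    (Nat.cast_le.2 (Finset.card_image_le.trans_eq (by simp)))
  · intro x hx y hy hxy
    simp only [Finset.coe_image, Finset.coe_univ, Set.image_univ] at hx hy
    obtain ⟨a, rfl⟩ := hx
    obtain ⟨b, rfl⟩ := hy
    rcases lt_trichotomy a b with h | h | h
    · exact (hsep a b h).2
    · exact absurd (congrArg p h) hxy
    · rw [SimpleGraph.adj_comm]
      exact (hsep b a h).2
  · intro v hv
    have hvn := v.isLt
    suffices h : ∃ j, v.val ≤ (p j).val + k ∧ (p j).val ≤ v.val + k ∨ n + (p j).val ≤ v.val + k by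
      obtain ⟨j, hj⟩ := h
      have hmem : p j ∈ Finset.univ.image p := Finset.mem_image_of_mem p (Finset.mem_univ j)
      exact ⟨p j, hmem, hnear v (p j) (fun h => hv (h ▸ hmem)) hj⟩
    have hdpos : 0 < d := by omega
    have hdiv := Nat.div_add_mod v.val d
    have hmod := Nat.mod_lt v.val hdpos
    have ham : v.val / d < m + 1 := by
      rw [Nat.div_lt_iff_lt_mul hdpos, Nat.add_mul, one_mul]
      omega
    rw [mul_comm] at hdiv
    generalize v.val / d = a at hdiv ham
    -- A small remainder is served by the point on the left, a large one by the next point; past the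
    -- last multiple of `d` this is 0 by wrapping, or the capped point.
    rcases Nat.lt_or_ge (v.val % d) (k + 1) with hr | hr
    · refine ⟨⟨a, ham⟩, ?_⟩
      simp only [p]
      omega
    · rcases Nat.lt_or_ge a m with h | h
      · refine ⟨⟨a + 1, by omega⟩, ?_⟩
        simp only [p, Nat.add_mul, one_mul]
        omega
      · obtain rfl : a = m := by omega
        by_cases hc : a * d ≤ n - k - 1
        · refine ⟨⟨0, by omega⟩, ?_⟩
          simp only [p, zero_mul]
          omega
        · refine ⟨⟨a, ham⟩, ?_⟩
          simp only [p]
          omega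

theorem natCeil_div_two_mul_add_one :
    ⌈(n : ℚ) / (2 * k + 1)⌉₊ =
      if n % (2 * k + 1) = 0 then n / (2 * k + 1) else n / (2 * k + 1) + 1 := by
  have hdiv := Nat.div_add_mod n (2 * k + 1)
  have hmod := Nat.mod_lt n (Nat.succ_pos (2 * k))
  generalize n / (2 * k + 1) = q at *
  generalize n % (2 * k + 1) = r at *
  have hn' : (n : ℚ) = (2 * k + 1) * q + r := by exact_mod_cast hdiv.symm
  have hpos : (0 : ℚ) < 2 * k + 1 := by positivity
  split_ifs with h
  · rw [hn', h, Nat.cast_zero, add_zero, mul_div_cancel_left₀ _ hpos.ne', Nat.ceil_natCast]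
  · rw [Nat.ceil_eq_iff (Nat.succ_ne_zero q), hn', lt_div_iff₀ hpos, div_le_iff₀ hpos,
      Nat.succ_sub_one]
    have h₁ : (1 : ℚ) ≤ r := by exact_mod_cast Nat.one_le_iff_ne_zero.2 h
    have h₂ : (r : ℚ) ≤ 2 * k + 1 := by exact_mod_cast hmod.le
    push_cast
    constructor <;> nlinarith

end

theorem corollary4p5 (K : Type*) [Field K] (n k : ℕ) (hk : 1 ≤ k) (hn : 3 ≤ n) :
    (n ≤ 2 * k + 1 → depthCyclePower K n k = 1) ∧
    (2 * k + 2 ≤ n →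
      ((n % (2 * k + 1) = 0 ∨ k + 1 ≤ n % (2 * k + 1)) →
        depthCyclePower K n k = ((⌈(n : ℚ) / (2 * k + 1)⌉₊ : ℕ) : ℕ∞)) ∧
      ((1 ≤ n % (2 * k + 1) ∧ n % (2 * k + 1) ≤ k) →
        ((⌈(n : ℚ) / (2 * k + 1)⌉₊ - 1 : ℕ) : ℕ∞) ≤ depthCyclePower K n k ∧
        depthCyclePower K n k ≤ ((⌈(n : ℚ) / (2 * k + 1)⌉₊ : ℕ) : ℕ∞))) := by
  have hn2 : 2 ≤ n := by omega
  refine ⟨fun h => le_antisymm ?_ (one_le_depthCyclePower hn2), fun h => ?_⟩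
  · exact_mod_cast depthCyclePower_le (K := K) (k := k) (m := 1) hn2 le_rfl (by omega) (by omega)
  · have hkn : k < n := by omega
    rw [natCeil_div_two_mul_add_one]
    have hdiv := Nat.div_add_mod n (2 * k + 1)
    have hmod := Nat.mod_lt n (Nat.succ_pos (2 * k))
    have hq : 1 ≤ n / (2 * k + 1) := (Nat.one_le_div_iff (by omega)).2 (by omega)
    rw [mul_comm] at hdiv
    generalize n / (2 * k + 1) = q at *
    generalize n % (2 * k + 1) = r at *
    -- With the products rewritten through `q * (2 * k + 1)`, the remaining inequalities are linear.
    have hsucc : (q + 1) * (2 * k + 1) = q * (2 * k + 1) + (2 * k + 1) := by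
      rw [Nat.add_mul, one_mul]
    have hpred : (q - 1) * (2 * k + 1) + (2 * k + 1) = q * (2 * k + 1) := by
      rw [← Nat.succ_mul, Nat.succ_eq_add_one, Nat.sub_add_cancel hq]
    refine ⟨fun hr => ?_, fun hr => ?_⟩
    · split_ifs with h0
      · exact le_antisymm (depthCyclePower_le hn2 hq (by omega) (by omega))
          (le_depthCyclePower hn2 hkn (by omega))
      · exact le_antisymm (depthCyclePower_le hn2 (by omega) (by rw [Nat.add_sub_cancel]; omega)
          (by omega)) (le_depthCyclePower hn2 hkn (by omega))
    · rw [if_neg (by omega), Nat.add_sub_cancel]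
      exact ⟨le_depthCyclePower hn2 hkn (by omega), depthCyclePower_le hn2 (by omega)
        (by rw [Nat.add_sub_cancel]; omega) (by omega)⟩
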